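/- There exists a constant $A > 0$ such that for every integer $m \ge 0$, all primes $q_1 < q_2 < \cdots < q_m$ and $n = q_1 q_2 \cdots q_m$ (that is, for every squarefree positive integer $n$): if $n \geq A$, then $$e^{\gamma}\, n \log\log n - \sigma(n) > 0,$$ where $\gamma$ is Euler's constant and $\sigma(n) = \sum_{d \mid n} d$ is the sum of the positive divisors of $n$. -/

import Mathlib

open scoped BigOperators

/-!
A squarefree `n` has `σ(n) / n = ∏_{p ∣ n} (1 + 1/p)`. Put `x = log n` and `L = log x`. At most
`x / L` prime factors of `n` exceed `x`, so these contribute a factor of at most `exp (1 / L)`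
(`prod_one_add_inv_le_exp_mul`), and it remains to bound `∏_{p ≤ x} (1 + 1/p)` by `C * L` with a
constant `C < e^γ`.

The sharp constant here is `6 e^γ / π²`, so there is room to avoid Mertens' third theorem.
With `s = 1 + 1/L` the product is compared to the product of `1 + p^{-s}`: each
factor changes by at most `exp ((s - 1) log p / p)` (`one_add_inv_le`), and the elementary bound
`∑_{p ≤ x} log p / p ≤ log x + log 4` (`sum_log_div_le`) makes the total loss `e ^ (1 + o(1))`.
Since `1 + y = (1 - y²) / (1 - y)`, the Euler product gives
`∏ (1 + p^{-s}) ≤ ζ(s) ∏_{p ≤ 5} (1 - p^{-2s})` (`prod_one_add_rpow_neg_le`), where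
`ζ(s) ≤ 1 + 1/(s - 1) = 1 + L`. As `s → 1` the product over `p ∈ {2, 3, 5}` tends to
`3/4 * 8/9 * 24/25 = 16/25`. Altogether `C = 16/25 * e ≈ 1.740`, and this is less than
`e^γ ≈ 1.781` (`sixteen_div_mul_exp_one_lt`).
-/

open Filter Topology

/-! ### Sums and products over primes -/

/-- The upper bound in Mertens' first theorem: `∏ p ^ ⌊N / p⌋` divides `N!`, and `log N!` is at
most `N log N`; replacing `⌊N / p⌋` by `N / p` costs at most `θ(N) ≤ N log 4`. -/
theorem sum_log_div_le {N : ℕ} (hN : 0 < N) :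
    ∑ p ∈ N.primesLE, Real.log p / p ≤ Real.log N + Real.log 4 := by
  have hN' : (0 : ℝ) < N := by exact_mod_cast hN
  have hdvd : ∏ p ∈ N.primesLE, p ^ (N / p) ∣ N.factorial := by
    refine Finset.prod_dvd_of_isRelPrime ?_ ?_
    · intro p hp q hq hpq
      exact Nat.coprime_iff_isRelPrime.1 (Nat.Coprime.pow _ _ ((Nat.coprime_primes
        (Nat.prime_of_mem_primesLE hp) (Nat.prime_of_mem_primesLE hq)).2 hpq))
    · intro p hp
      rw [(Nat.prime_of_mem_primesLE hp).pow_dvd_factorial_iff (b := Nat.log p N + 2) (by omega)]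
      simpa using Finset.single_le_sum (f := fun i => N / p ^ i) (fun i _ => Nat.zero_le _)
        (Finset.mem_Ico.2 ⟨le_rfl, by omega⟩ : 1 ∈ Finset.Ico 1 (Nat.log p N + 2))
  have hle : ∏ p ∈ N.primesLE, p ^ (N / p) ≤ N ^ N :=
    (Nat.le_of_dvd N.factorial_pos hdvd).trans N.factorial_le_pow
  have hpos : ∀ p ∈ N.primesLE, (0 : ℝ) < p := fun p hp => by
    exact_mod_cast (Nat.prime_of_mem_primesLE hp).pos
  have hlog : ∑ p ∈ N.primesLE, ((N / p : ℕ) : ℝ) * Real.log p ≤ N * Real.log N := by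
    have h1 : (∏ p ∈ N.primesLE, (p : ℝ) ^ (N / p)) ≤ (N : ℝ) ^ N := by exact_mod_cast hle
    have h2 := Real.log_le_log (Finset.prod_pos fun p hp => pow_pos (hpos p hp) _) h1
    rw [Real.log_prod fun p hp => (pow_pos (hpos p hp) _).ne'] at h2
    simpa [Real.log_pow] using h2
  have hθ : ∑ p ∈ N.primesLE, Real.log p ≤ Real.log 4 * N := by
    rw [← Chebyshev.theta_eq_sum_primesLE_log]
    exact Chebyshev.theta_le_log4_mul_x hN'.le
  have hkey : N * ∑ p ∈ N.primesLE, Real.log p / p ≤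
      ∑ p ∈ N.primesLE, ((N / p : ℕ) : ℝ) * Real.log p + ∑ p ∈ N.primesLE, Real.log p := by
    rw [Finset.mul_sum, ← Finset.sum_add_distrib]
    refine Finset.sum_le_sum fun p hp => ?_
    have h1 : (N : ℝ) / p ≤ ((N / p : ℕ) : ℝ) + 1 := by
      rw [← Nat.floor_div_eq_div (K := ℝ)]
      exact (Nat.lt_floor_add_one _).le
    have h2 : 0 ≤ Real.log p := Real.log_natCast_nonneg p
    calc (N : ℝ) * (Real.log p / p) = N / p * Real.log p := by ring
      _ ≤ (((N / p : ℕ) : ℝ) + 1) * Real.log p := by gcongr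
      _ = _ := by ring
  refine le_of_mul_le_mul_left ?_ hN'
  linarith

/-- With `u = (s - 1) log p / p`, the inequality `p^{-s} = p⁻¹ exp (-(s - 1) log p) ≥ p⁻¹ - u`
is a tangent-line bound, and so is `exp u ≥ 1 + u`. -/
theorem one_add_inv_le {p s : ℝ} (hp : 1 ≤ p) (hs : 1 ≤ s) :
    1 + p⁻¹ ≤ (1 + p ^ (-s)) * Real.exp ((s - 1) * (Real.log p / p)) := by
  have hp0 : 0 < p := by linarith
  set u := (s - 1) * (Real.log p / p) with hu
  have hu0 : 0 ≤ u :=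
    mul_nonneg (by linarith) (div_nonneg (Real.log_nonneg hp) hp0.le)
  have hy : p⁻¹ - u ≤ p ^ (-s) := by
    have h1 : p ^ (-s) = p⁻¹ * Real.exp (-((s - 1) * Real.log p)) := by
      rw [show -s = -1 + -(s - 1) by ring, Real.rpow_add hp0, Real.rpow_neg_one,
        Real.rpow_def_of_pos hp0]
      ring_nf
    have h2 := Real.add_one_le_exp (-((s - 1) * Real.log p))
    calc p⁻¹ - u = p⁻¹ * (-((s - 1) * Real.log p) + 1) := by rw [hu]; ring
      _ ≤ _ := by rw [h1]; gcongr
  have hy0 : 0 < p ^ (-s) := Real.rpow_pos_of_pos hp0 _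
  calc 1 + p⁻¹ ≤ (1 + p ^ (-s)) * (u + 1) := by nlinarith
    _ ≤ _ := by
      gcongr
      exact Real.add_one_le_exp u

/-- A partial Euler product for `ζ(s)` is at most `ζ(s)`, hence at most `1 + 1 / (s - 1)`. -/
theorem prod_primesBelow_inv_one_sub_rpow_neg_le {s : ℝ} (hs : 1 < s) (N : ℕ) :
    ∏ p ∈ N.primesBelow, (1 - (p : ℝ) ^ (-s))⁻¹ ≤ 1 + 1 / (s - 1) := by
  let f : ℕ →*₀ ℝ :=
    { toFun := fun n => (n : ℝ) ^ (-s)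
      map_zero' := by simp [Real.zero_rpow (by linarith : -s ≠ 0)]
      map_one' := by simp
      map_mul' := fun a b => by
        push_cast
        exact Real.mul_rpow a.cast_nonneg b.cast_nonneg }
  have hsum : Summable f := Real.summable_nat_rpow.2 (by linarith)
  have h1 := EulerProduct.prod_primesBelow_geometric_eq_tsum_smoothNumbers
    (f := (f : ℕ →* ℝ)) hsum N
  have h2 : ∑' m : N.smoothNumbers, f m ≤ ∑' n, f n :=
    Summable.tsum_subtype_le (fun n => f n) _
      (fun n => Real.rpow_nonneg n.cast_nonneg _) hsum
  have h3 : ∑' n, f n = ∑' n : ℕ, 1 / (n + 1 : ℝ) ^ s := by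
    rw [hsum.tsum_eq_zero_add, map_zero, zero_add]
    refine tsum_congr fun n => ?_
    change ((n + 1 : ℕ) : ℝ) ^ (-s) = _
    rw [Real.rpow_neg (Nat.cast_nonneg _), one_div]
    push_cast
    rfl
  have h4 := ZetaAsymptotics.zeta_limit_aux1 hs
  have h5 : 0 ≤ s * ZetaAsymptotics.termTSum s :=
    mul_nonneg (by linarith) (tsum_nonneg fun n => ZetaAsymptotics.term_nonneg _ _)
  calc _ = ∑' m : N.smoothNumbers, f m := h1
    _ ≤ _ := by rw [h3] at h2; linarith

/-- Writing `1 + y = (1 - y²) / (1 - y)` with `y = p^{-s}` separates a partial Euler product for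
`ζ(s)`; of the factors `1 - y² ≤ 1` only those at `2, 3, 5` are kept. -/
theorem prod_one_add_rpow_neg_le {s : ℝ} (hs : 1 < s) {N : ℕ} (hN : 5 ≤ N) :
    ∏ p ∈ N.primesLE, (1 + (p : ℝ) ^ (-s)) ≤
      (∏ p ∈ ({2, 3, 5} : Finset ℕ), (1 - ((p : ℝ) ^ (-s)) ^ 2)) * (1 + 1 / (s - 1)) := by
  have hlt : ∀ p : ℕ, p.Prime → (p : ℝ) ^ (-s) < 1 := fun p hp =>
    Real.rpow_lt_one_of_one_lt_of_neg (by exact_mod_cast hp.one_lt) (by linarith)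
  have hnn : ∀ p : ℕ, 0 ≤ (p : ℝ) ^ (-s) := fun p => Real.rpow_nonneg p.cast_nonneg _
  have hsub : ({2, 3, 5} : Finset ℕ) ⊆ N.primesLE := by
    intro p hp
    simp only [Finset.mem_insert, Finset.mem_singleton] at hp
    rw [Nat.mem_primesLE]
    rcases hp with rfl | rfl | rfl <;> exact ⟨by omega, by norm_num⟩
  have hsq : ∀ p ∈ N.primesLE, 0 ≤ 1 - ((p : ℝ) ^ (-s)) ^ 2 := fun p hp => by
    nlinarith [hlt p (Nat.prime_of_mem_primesLE hp), hnn p]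
  have h1 : ∏ p ∈ N.primesLE, (1 + (p : ℝ) ^ (-s)) =
      (∏ p ∈ N.primesLE, (1 - ((p : ℝ) ^ (-s)) ^ 2)) *
        ∏ p ∈ N.primesLE, (1 - (p : ℝ) ^ (-s))⁻¹ := by
    rw [← Finset.prod_mul_distrib]
    refine Finset.prod_congr rfl fun p hp => ?_
    have := sub_pos.2 (hlt p (Nat.prime_of_mem_primesLE hp))
    field_simp
    ring
  have h2 : ∏ p ∈ N.primesLE, (1 - ((p : ℝ) ^ (-s)) ^ 2) ≤
      ∏ p ∈ ({2, 3, 5} : Finset ℕ), (1 - ((p : ℝ) ^ (-s)) ^ 2) := by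
    rw [← Finset.prod_sdiff hsub]
    refine mul_le_of_le_one_left (Finset.prod_nonneg fun p hp => hsq p (hsub hp)) ?_
    refine Finset.prod_le_one (fun p hp => hsq p (Finset.sdiff_subset hp)) fun p _ => ?_
    nlinarith [hnn p]
  rw [h1]
  refine mul_le_mul h2 (prod_primesBelow_inv_one_sub_rpow_neg_le hs (N + 1)) ?_ ?_
  · exact Finset.prod_nonneg fun p hp =>
      inv_nonneg.2 (sub_pos.2 (hlt p (Nat.prime_of_mem_primesLE hp))).le
  · exact Finset.prod_nonneg fun p hp => hsq p (hsub hp)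

theorem prod_one_add_inv_le {s : ℝ} (hs : 1 < s) {N : ℕ} (hN : 5 ≤ N) :
    ∏ p ∈ N.primesLE, (1 + (p : ℝ)⁻¹) ≤
      (∏ p ∈ ({2, 3, 5} : Finset ℕ), (1 - ((p : ℝ) ^ (-s)) ^ 2)) * (1 + 1 / (s - 1)) *
        Real.exp ((s - 1) * (Real.log N + Real.log 4)) := by
  calc ∏ p ∈ N.primesLE, (1 + (p : ℝ)⁻¹)
      ≤ ∏ p ∈ N.primesLE, ((1 + (p : ℝ) ^ (-s)) * Real.exp ((s - 1) * (Real.log p / p))) :=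
        Finset.prod_le_prod (fun p _ => by positivity) fun p hp => one_add_inv_le (by
          exact_mod_cast (Nat.prime_of_mem_primesLE hp).one_le) hs.le
    _ = (∏ p ∈ N.primesLE, (1 + (p : ℝ) ^ (-s))) *
          Real.exp ((s - 1) * ∑ p ∈ N.primesLE, Real.log p / p) := by
        rw [Finset.prod_mul_distrib, Finset.mul_sum, Real.exp_sum]
    _ ≤ _ := by
        gcongr ?_ * Real.exp ?_
        · exact (Finset.prod_nonneg fun p _ => by positivity).trans
            (prod_one_add_rpow_neg_le hs hN)
        · exact prod_one_add_rpow_neg_le hs hN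
        · exact mul_le_mul_of_nonneg_left (sum_log_div_le (by omega)) (by linarith)

/-! ### Squarefree numbers -/

/-- The primes in `T` exceeding `x = log ∏ T` number at most `x / log x`, and each contributes a
factor of at most `1 + 1 / x ≤ exp (1 / x)`. -/
theorem prod_one_add_inv_le_exp_mul {T : Finset ℕ} (hT : ∀ p ∈ T, p.Prime) {x : ℝ} (hx : 1 < x)
    (hTx : Real.log (∏ p ∈ T, p : ℕ) = x) :
    ∏ p ∈ T, (1 + (p : ℝ)⁻¹) ≤
      Real.exp (1 / Real.log x) * ∏ p ∈ ⌊x⌋₊.primesLE, (1 + (p : ℝ)⁻¹) := by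
  have hL : 0 < Real.log x := Real.log_pos hx
  have hx0 : 0 < x := by linarith
  rw [← Finset.prod_filter_not_mul_prod_filter T (fun p : ℕ => (p : ℝ) ≤ x)]
  refine mul_le_mul ?_ ?_ (Finset.prod_nonneg fun p _ => by positivity) (Real.exp_pos _).le
  · have hbig : ∀ p ∈ T.filter (fun p : ℕ => ¬(p : ℝ) ≤ x), x ≤ p := fun p hp =>
      (not_le.1 (Finset.mem_filter.1 hp).2).le
    have hcard : ((T.filter (fun p : ℕ => ¬(p : ℝ) ≤ x)).card : ℝ) * Real.log x ≤ x := by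
      calc ((T.filter (fun p : ℕ => ¬(p : ℝ) ≤ x)).card : ℝ) * Real.log x
          = ∑ p ∈ T.filter (fun p : ℕ => ¬(p : ℝ) ≤ x), Real.log x := by simp
        _ ≤ ∑ p ∈ T.filter (fun p : ℕ => ¬(p : ℝ) ≤ x), Real.log p :=
            Finset.sum_le_sum fun p hp => Real.log_le_log hx0 (hbig p hp)
        _ ≤ ∑ p ∈ T, Real.log p :=
            Finset.sum_le_sum_of_subset_of_nonneg (Finset.filter_subset _ _)
              fun p _ _ => Real.log_natCast_nonneg p
        _ = x := by
            rw [← hTx, Nat.cast_prod, Real.log_prod fun p hp => by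
              exact_mod_cast (hT p hp).ne_zero]
    calc ∏ p ∈ T.filter (fun p : ℕ => ¬(p : ℝ) ≤ x), (1 + (p : ℝ)⁻¹)
        ≤ ∏ p ∈ T.filter (fun p : ℕ => ¬(p : ℝ) ≤ x), Real.exp x⁻¹ := by
          refine Finset.prod_le_prod (fun p _ => by positivity) fun p hp => ?_
          have h1 : (p : ℝ)⁻¹ ≤ x⁻¹ := inv_anti₀ hx0 (hbig p hp)
          linarith [Real.add_one_le_exp x⁻¹]
      _ = Real.exp ((T.filter (fun p : ℕ => ¬(p : ℝ) ≤ x)).card * x⁻¹) := by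
          rw [Finset.prod_const, ← Real.exp_nat_mul]
      _ ≤ Real.exp (1 / Real.log x) := by
          gcongr
          rw [← div_eq_mul_inv, div_le_div_iff₀ hx0 hL]
          linarith
  · refine Finset.prod_le_prod_of_subset_of_one_le (fun p hp => ?_)
      (fun p _ => by positivity) fun p _ _ => le_add_of_nonneg_right (by positivity)
    obtain ⟨hpT, hpx⟩ := Finset.mem_filter.1 hp
    exact Nat.mem_primesLE.2 ⟨Nat.le_floor hpx, hT p hpT⟩

theorem sigma_one_prod_primes {T : Finset ℕ} (hT : ∀ p ∈ T, p.Prime) :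
    (ArithmeticFunction.sigma 1 (∏ p ∈ T, p) : ℝ) =
      (∏ p ∈ T, p : ℕ) * ∏ p ∈ T, (1 + (p : ℝ)⁻¹) := by
  rw [ArithmeticFunction.IsMultiplicative.map_prod_of_prime
    ArithmeticFunction.isMultiplicative_sigma T hT]
  push_cast
  rw [← Finset.prod_mul_distrib]
  refine Finset.prod_congr rfl fun p hp => ?_
  have hp0 : (p : ℝ) ≠ 0 := by exact_mod_cast (hT p hp).ne_zero
  have h := ArithmeticFunction.sigma_one_apply_prime_pow (i := 1) (hT p hp)
  rw [pow_one] at h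
  rw [h]
  simp [Finset.sum_range_succ]
  field_simp
  ring

/-! ### The constant -/

/-- Follows from `γ > H₃₁ - log 32` and `e > 2.7182818283`. -/
theorem sixteen_div_mul_exp_one_lt :
    16 / 25 * Real.exp 1 < Real.exp Real.eulerMascheroniConstant := by
  have h1 := Real.eulerMascheroniSeq_lt_eulerMascheroniConstant 31
  have hH : (4.0272 : ℚ) ≤ harmonic 31 := by
    norm_num [harmonic, Finset.sum_range_succ]
  have hH' : (4.0272 : ℝ) ≤ (harmonic 31 : ℝ) := by
    have := (Rat.cast_le (K := ℝ)).2 hH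
    norm_num at this ⊢
  rw [Real.eulerMascheroniSeq] at h1
  have h2 : Real.exp (4.0272 - Real.log 32) < Real.exp Real.eulerMascheroniConstant := by
    apply Real.exp_lt_exp.2
    norm_num at h1 hH' ⊢
    linarith
  refine lt_of_le_of_lt ?_ h2
  rw [Real.exp_sub, Real.exp_log (by norm_num),
    show (4.0272 : ℝ) = 1 + (1 + 1 + 1 + 0.0272) by norm_num, Real.exp_add,
    Real.exp_add (1 + 1 + 1), Real.exp_add (1 + 1), Real.exp_add 1 1]
  have h3 := Real.exp_one_gt_d9
  have h4 := Real.add_one_le_exp (0.0272 : ℝ)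
  have h5 : (2.7182818283 * 2.7182818283 * 2.7182818283 * 1.0272 : ℝ) ≤
      Real.exp 1 * Real.exp 1 * Real.exp 1 * Real.exp 0.0272 := by
    gcongr
    linarith
  have h6 : (20.48 : ℝ) ≤ Real.exp 1 * Real.exp 1 * Real.exp 1 * Real.exp 0.0272 :=
    le_trans (by norm_num) h5
  rw [le_div_iff₀ (by norm_num)]
  nlinarith [Real.exp_pos 1]

/-- The left side is the bound for `σ(n) / n` obtained with `L = log log n` and `s = 1 + 1 / L`. -/
theorem eventually_bound_lt :
    ∀ᶠ L : ℝ in atTop,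
      Real.exp (1 / L) * ((∏ p ∈ ({2, 3, 5} : Finset ℕ), (1 - ((p : ℝ) ^ (-(1 + 1 / L))) ^ 2)) *
        (1 + L) * Real.exp (1 / L * (L + Real.log 4))) <
          Real.exp Real.eulerMascheroniConstant * L := by
  -- After division by `L` and the substitution `t = 1 / L`, this is continuity at `t = 0`.
  let g : ℝ → ℝ := fun t => Real.exp t *
    ((∏ p ∈ ({2, 3, 5} : Finset ℕ), (1 - ((p : ℝ) ^ (-(1 + t))) ^ 2)) *
      (t + 1) * Real.exp (1 + t * Real.log 4))
  have hg : Continuous g := by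
    refine Real.continuous_exp.mul (((continuous_finsetProd _ fun p hp => ?_).mul
      (by fun_prop)).mul (by fun_prop))
    have hp0 : (p : ℝ) ≠ 0 := by
      rintro h
      simp [Nat.cast_eq_zero.1 h] at hp
    exact continuous_const.sub ((continuous_const.rpow (by fun_prop)
      fun _ => Or.inl hp0).pow 2)
  have hg0 : g 0 = 16 / 25 * Real.exp 1 := by
    simp only [g]
    norm_num [Real.rpow_neg_one]
  have hlim : Tendsto (fun L : ℝ => g (1 / L)) atTop (𝓝 (g 0)) :=
    (hg.tendsto 0).comp (tendsto_const_nhds.div_atTop tendsto_id)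
  have hlt : g 0 < Real.exp Real.eulerMascheroniConstant := hg0 ▸ sixteen_div_mul_exp_one_lt
  filter_upwards [hlim.eventually_lt_const hlt, eventually_gt_atTop 0] with L h1 hL
  have h2 := mul_lt_mul_of_pos_right h1 hL
  refine lt_of_eq_of_lt ?_ h2
  have h3 : 1 / L * (L + Real.log 4) = 1 + 1 / L * Real.log 4 := by field_simp
  have h4 : 1 + L = (1 / L + 1) * L := by field_simp
  simp only [g]
  rw [h3, h4]
  ring

theorem mainTheorem6 :
    ∃ A : ℝ, 0 < A ∧
      ∀ (m : ℕ) (q : Fin m → ℕ), (∀ k, (q k).Prime) → StrictMono q →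
        ∀ n : ℕ, n = ∏ k, q k → A ≤ (n : ℝ) →
          0 < Real.exp Real.eulerMascheroniConstant * (n : ℝ) * Real.log (Real.log (n : ℝ))
            - (ArithmeticFunction.sigma 1 n : ℝ) := by
  have hloglog : Tendsto (fun y : ℝ => Real.log (Real.log y)) atTop atTop :=
    Real.tendsto_log_atTop.comp Real.tendsto_log_atTop
  obtain ⟨A, hA⟩ := eventually_atTop.1 ((hloglog.eventually eventually_bound_lt).and
    (Real.tendsto_log_atTop.eventually_ge_atTop 5))
  refine ⟨max A 1, by positivity, fun m q hq hmono n hn hAn => ?_⟩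
  obtain ⟨hlt, hx5⟩ := hA n ((le_max_left _ _).trans hAn)
  have hn0 : (0 : ℝ) < n := lt_of_lt_of_le (by positivity) hAn
  set x := Real.log (n : ℝ) with hx
  set L := Real.log x with hL
  have hL0 : 0 < L := Real.log_pos (by linarith)
  set T : Finset ℕ := Finset.univ.map ⟨q, hmono.injective⟩ with hTdef
  have hT : ∀ p ∈ T, p.Prime := by
    intro p hp
    obtain ⟨k, -, rfl⟩ := Finset.mem_map.1 hp
    exact hq k
  have hnT : n = ∏ p ∈ T, p := by rw [hn, hTdef, Finset.prod_map]; rfl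
  have hfloor : 5 ≤ ⌊x⌋₊ := Nat.le_floor (by exact_mod_cast hx5)
  have hlogfloor : Real.log ⌊x⌋₊ ≤ L :=
    Real.log_le_log (by exact_mod_cast (by omega : 0 < ⌊x⌋₊)) (Nat.floor_le (by linarith))
  have h1 := prod_one_add_inv_le_exp_mul hT (x := x) (by linarith) (by rw [← hnT])
  have h2 := prod_one_add_inv_le (s := 1 + 1 / L)
    (by linarith [one_div_pos.2 hL0]) hfloor
  rw [add_sub_cancel_left, one_div_one_div] at h2
  have hprod : ∏ p ∈ T, (1 + (p : ℝ)⁻¹) < Real.exp Real.eulerMascheroniConstant * L := by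
    refine lt_of_le_of_lt (h1.trans ?_) hlt
    gcongr
    refine h2.trans ?_
    gcongr
    exact (mul_nonneg_iff_of_pos_right (Real.exp_pos _)).1
      ((Finset.prod_nonneg fun p _ => by positivity).trans h2)
  rw [hnT, sigma_one_prod_primes hT, ← hnT]
  nlinarith [mul_lt_mul_of_pos_left hprod hn0]
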